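/- Let $d\ge 2$, $0<\alpha\le\infty$, and put $\|t\|_\alpha=\bigl(\sum_{i=1}^d|t_i|^\alpha\bigr)^{1/\alpha}$ for $\alpha<\infty$, $\|t\|_\infty=\max_i|t_i|$. Let $P$ be a Borel probability measure on $\mathbb{R}^d$ with $P(\{0\})=0$ that is $\alpha$-symmetric, i.e. the characteristic function of $X=(X_1,\dots,X_d)\sim P$ has the form $t\mapsto\phi(\|t\|_\alpha)$ with $\phi$ continuous, and let $F(t)=\mathbb{P}(X_1\le t)$. For a positive definite $d\times d$ matrix $\Sigma$ the scatter halfspace depth is $$\mathrm{SHD}(\Sigma;P)=\inf_{\|u\|_2=1}\min\Bigl\{\mathbb{P}\bigl(|\langle X-T(P),u\rangle|\le\sqrt{u^{\mathsf T}\Sigma u}\bigr),\ \mathbb{P}\bigl(|\langle X-T(P),u\rangle|\ge\sqrt{u^{\mathsf T}\Sigma u}\bigr)\Bigr\},$$ where $T(P)$ is the halfspace median of $P$, that is, the barycenter of the set of maximizers $x\in\mathbb{R}^d$ of the halfspace depth $\inf_{\|u\|_2=1}\mathbb{P}(\langle X,u\rangle\le\langle x,u\rangle)$. The scatter halfspace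 median set of $P$ is the set of all positive definite matrices that maximize $\mathrm{SHD}(\cdot;P)$ over all positive definite matrices, and the scatter halfspace median matrix is its barycenter. Then the equation $$F(\sigma d^{1/2-1/\alpha})-\tfrac12=1-F(\sigma)$$ (with $1/\infty=0$) has exactly one real solution $\sigma$; it satisfies $\sigma>0$. The scatter halfspace median set of $P$ is $\{\sigma^2 I\}$, so that the scatter halfspace median matrix is $\sigma^2 I$. The maximal scatter halfspace depth of $P$ is $\mathrm{SHD}(\sigma^2I;P)=\max_{\Sigma}\mathrm{SHD}(\Sigma;P)$, and it equals $$2F(\sigma d^{1/2-1/\alpha})-1=2-2F(\sigma)\quad\text{if }\alpha\le 2,\qquad 2F(\sigma)-1=2-2F(\sigma d^{1/2-1/\alpha})\quad\text{if }\alpha\ge 2 .$$ -/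

import Mathlib

open MeasureTheory
open scoped ENNReal

noncomputable section

namespace ScatterDepth

variable {d : ℕ}

/-- The `α`-norm of `t ∈ ℝᵈ`: `(∑ |tᵢ|^α)^(1/α)` for `0 < α < ∞` and `max |tᵢ|` for `α = ∞`
(for `α < 1` it does not satisfy the triangle inequality). -/
def alphaNorm (α : ℝ≥0∞) (t : EuclideanSpace ℝ (Fin d)) : ℝ :=
  if α = ∞ then ⨆ i, |t i| else (∑ i, |t i| ^ α.toReal) ^ (1 / α.toReal)

/-- `P` is `α`-symmetric: its characteristic function is `φ (‖t‖_α)` for some continuous `φ`. -/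
def IsAlphaSymmetric (α : ℝ≥0∞) (P : Measure (EuclideanSpace ℝ (Fin d))) : Prop :=
  ∃ φ : ℝ → ℂ, Continuous φ ∧ ∀ t, charFun P t = φ (alphaNorm α t)

/-- The distribution function `t ↦ ℙ(Xᵢ ≤ t)` of the `i`-th coordinate of `X ∼ P`. -/
def marginalCDF (P : Measure (EuclideanSpace ℝ (Fin d))) (i : Fin d) (t : ℝ) : ℝ :=
  P.real {x | x i ≤ t}

/-- The (location) halfspace depth `inf_{‖u‖ = 1} ℙ(⟨X, u⟩ ≤ ⟨x, u⟩)`. -/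
def halfspaceDepth (P : Measure (EuclideanSpace ℝ (Fin d))) (x : EuclideanSpace ℝ (Fin d)) : ℝ :=
  ⨅ u : Metric.sphere (0 : EuclideanSpace ℝ (Fin d)) 1,
    P.real {y | inner ℝ y u.1 ≤ inner ℝ x u.1}

/-- The halfspace median set: all points of maximal halfspace depth. -/
def halfspaceMedianSet (P : Measure (EuclideanSpace ℝ (Fin d))) :
    Set (EuclideanSpace ℝ (Fin d)) :=
  {x | IsMaxOn (halfspaceDepth P) Set.univ x}

/-- The barycenter of a nonempty compact convex set `S`: the mean of the uniform distribution
on `S`, i.e. of the normalized Hausdorff measure on `S` in the dimension of its affine hull. -/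
def uniformBarycenter {ι : Type*} [Fintype ι] (S : Set (EuclideanSpace ℝ ι)) :
    EuclideanSpace ℝ ι :=
  ⨍ x in S, x ∂(Measure.hausdorffMeasure (Module.finrank ℝ (vectorSpan ℝ S) : ℝ))

/-- The halfspace median: the barycenter of the halfspace median set. -/
def halfspaceMedian (P : Measure (EuclideanSpace ℝ (Fin d))) : EuclideanSpace ℝ (Fin d) :=
  uniformBarycenter (halfspaceMedianSet P)

/-- `√(uᵀ Σ u)`. -/
def sqrtQuadForm (S : Matrix (Fin d) (Fin d) ℝ) (u : EuclideanSpace ℝ (Fin d)) : ℝ :=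
  Real.sqrt (u.ofLp ⬝ᵥ (S.mulVec u.ofLp))

/-- The scatter halfspace depth of `S` with respect to `P`, with the halfspace median of `P` as
the location functional. -/
def scatterDepth (P : Measure (EuclideanSpace ℝ (Fin d))) (S : Matrix (Fin d) (Fin d) ℝ) : ℝ :=
  ⨅ u : Metric.sphere (0 : EuclideanSpace ℝ (Fin d)) 1,
    min (P.real {x | |inner ℝ (x - halfspaceMedian P) u.1| ≤ sqrtQuadForm S u.1})
      (P.real {x | sqrtQuadForm S u.1 ≤ |inner ℝ (x - halfspaceMedian P) u.1|})

/-- The scatter halfspace median set: all positive definite matrices that maximize the scatter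
halfspace depth over the positive definite matrices. -/
def scatterMedianSet (P : Measure (EuclideanSpace ℝ (Fin d))) :
    Set (Matrix (Fin d) (Fin d) ℝ) :=
  {S | S.PosDef ∧ IsMaxOn (scatterDepth P) {A | A.PosDef} S}

/-- The scatter halfspace median matrix: the barycenter of the scatter halfspace median set,
matrices being regarded as vectors of `ℝ^(d × d)`. -/
def scatterMedianMatrix (P : Measure (EuclideanSpace ℝ (Fin d))) : Matrix (Fin d) (Fin d) ℝ :=
  Matrix.of fun i j =>
    uniformBarycenter ((fun S : Matrix (Fin d) (Fin d) ℝ =>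
      WithLp.toLp 2 fun p : Fin d × Fin d => S p.1 p.2) '' scatterMedianSet P) (i, j)

end ScatterDepth

end

/-! By `IsAlphaSymmetric.map_inner`, `⟨X, u⟩ / ‖u‖_α` has the law of one coordinate for every `u ≠
0`, so every halfspace or slab probability is a value of `F`. This rigidity makes `F` continuous
(`measure_coord_eq`) and strictly increasing on `[0, ∞)` until it reaches 1 (`marginalCDF_lt`).
Hence the halfspace median is 0. With `r(u) = √(uᵀ Σ u) / ‖u‖_α`, the scatter depth is the infimum
over unit `u` of `min (2F(r(u)) - 1) (2 - 2F(r(u)))`.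

A superlevel set of the depth thus confines `r` to an interval (`le_scatterDepth_iff`). For the
maximal level the endpoints are `σ` and `σc`, where `c = d^(1/2 - 1/α)` and `σ` is tuned by the
balance equation. Comparing the `α`-norm with the Euclidean norm shows that `σ² I` satisfies these
bounds.

Conversely, the coordinate directions bound the diagonal of `Σ` by `σ²` from one side, and the
diagonal directions `w/√d`, `w` a sign vector, bound `wᵀ Σ w` by `dσ²` from the other. Averaging
over all `w` gives the trace, so all these bounds are equalities and `Σ = σ² I`
(`eq_zero_of_sign_dotProduct_nonneg`). -/

open Filter Topology

namespace ScatterDepth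

variable {d : ℕ}

/-! ### The `α`-norm and its comparison with the Euclidean norm. -/

section AlphaNorm

variable {α : ℝ≥0∞}

theorem alphaNorm_top (t : EuclideanSpace ℝ (Fin d)) : alphaNorm ∞ t = ⨆ i, |t i| := if_pos rfl

theorem alphaNorm_of_ne_top (h : α ≠ ∞) (t : EuclideanSpace ℝ (Fin d)) :
    alphaNorm α t = (∑ i, |t i| ^ α.toReal) ^ (1 / α.toReal) := if_neg h

theorem alphaNorm_top_eq_norm (t : EuclideanSpace ℝ (Fin d)) : alphaNorm ∞ t = ‖t.ofLp‖ := by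
  rw [alphaNorm_top]
  exact ((PiLp.norm_eq_ciSup (WithLp.toLp ∞ t.ofLp)).symm.trans (PiLp.norm_toLp _))

theorem alphaNorm_nonneg (t : EuclideanSpace ℝ (Fin d)) : 0 ≤ alphaNorm α t := by
  by_cases h : α = ∞
  · subst h; rw [alphaNorm_top_eq_norm]; positivity
  · rw [alphaNorm_of_ne_top h]; positivity

theorem alphaNorm_pos (hα : 0 < α) {t : EuclideanSpace ℝ (Fin d)} (ht : t ≠ 0) :
    0 < alphaNorm α t := by
  by_cases h : α = ∞
  · subst h
    rw [alphaNorm_top_eq_norm, norm_pos_iff]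
    simpa using ht
  · rw [alphaNorm_of_ne_top h]
    obtain ⟨i, hi⟩ : ∃ i, t i ≠ 0 := by
      by_contra! H
      exact ht (by ext i; simpa using H i)
    apply Real.rpow_pos_of_pos
    exact Finset.sum_pos' (fun _ _ => by positivity)
      ⟨i, Finset.mem_univ i, Real.rpow_pos_of_pos (abs_pos.2 hi) _⟩

theorem alphaNorm_smul (hα : 0 < α) (r : ℝ) (t : EuclideanSpace ℝ (Fin d)) :
    alphaNorm α (r • t) = |r| * alphaNorm α t := by
  by_cases h : α = ∞
  · subst h
    rw [alphaNorm_top_eq_norm, alphaNorm_top_eq_norm, WithLp.ofLp_smul, norm_smul, Real.norm_eq_abs]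
  · have hp := ENNReal.toReal_pos hα.ne' h
    rw [alphaNorm_of_ne_top h, alphaNorm_of_ne_top h]
    simp only [PiLp.smul_apply, smul_eq_mul, abs_mul]
    simp_rw [Real.mul_rpow (abs_nonneg r) (abs_nonneg _)]
    rw [← Finset.mul_sum, Real.mul_rpow (by positivity) (by positivity), ← Real.rpow_mul (by positivity),
      mul_one_div_cancel hp.ne', Real.rpow_one]

theorem continuous_alphaNorm (hα : 0 < α) :
    Continuous (alphaNorm α : EuclideanSpace ℝ (Fin d) → ℝ) := by
  by_cases h : α = ∞
  · subst h
    simp_rw [funext alphaNorm_top_eq_norm]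
    fun_prop
  · have hp := ENNReal.toReal_pos hα.ne' h
    simp_rw [funext (alphaNorm_of_ne_top h)]
    refine Continuous.rpow_const ?_ fun _ => Or.inr (by positivity)
    refine continuous_finsetSum _ fun i _ => ?_
    exact Continuous.rpow_const (by fun_prop) fun _ => Or.inr hp.le

theorem alphaNorm_single (hα : 0 < α) (i : Fin d) :
    alphaNorm α (EuclideanSpace.single i (1 : ℝ)) = 1 := by
  by_cases h : α = ∞
  · subst h
    rw [alphaNorm_top_eq_norm, PiLp.ofLp_single, Pi.norm_single, norm_one]
  · have hp := ENNReal.toReal_pos hα.ne' h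
    rw [alphaNorm_of_ne_top h, Finset.sum_eq_single i]
    · simp
    · intro j _ hj
      simp [hj, Real.zero_rpow hp.ne']
    · simp

theorem alphaNorm_of_abs_eq [NeZero d] (hα : 0 < α) {t : EuclideanSpace ℝ (Fin d)} {r : ℝ}
    (hr : 0 ≤ r) (ht : ∀ i, |t i| = r) : alphaNorm α t = (d : ℝ) ^ (α⁻¹).toReal * r := by
  by_cases h : α = ∞
  · subst h
    simp [alphaNorm_top, ht]
  · have hp := ENNReal.toReal_pos hα.ne' h
    rw [alphaNorm_of_ne_top h]
    simp only [ht, Finset.sum_const, Finset.card_univ, Fintype.card_fin, nsmul_eq_mul]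
    rw [Real.mul_rpow (by positivity) (by positivity), ← Real.rpow_mul hr,
      mul_one_div_cancel hp.ne', Real.rpow_one, ENNReal.toReal_inv, one_div]

theorem sum_sq_eq_one {u : EuclideanSpace ℝ (Fin d)} (hu : ‖u‖ = 1) : ∑ i, |u i| ^ 2 = 1 := by
  have := EuclideanSpace.norm_sq_eq u
  rw [hu] at this
  simpa using this.symm

theorem abs_le_one_of_norm_eq_one {u : EuclideanSpace ℝ (Fin d)} (hu : ‖u‖ = 1) (i : Fin d) :
    |u i| ≤ 1 := by
  have := PiLp.norm_apply_le u i
  rwa [hu] at this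

theorem one_le_alphaNorm (hα : 0 < α) (hα2 : α ≤ 2) {u : EuclideanSpace ℝ (Fin d)}
    (hu : ‖u‖ = 1) : 1 ≤ alphaNorm α u := by
  have h : α ≠ ∞ := ne_top_of_le_ne_top (by simp) hα2
  have hp := ENNReal.toReal_pos hα.ne' h
  have hp2 : α.toReal ≤ 2 := by simpa using ENNReal.toReal_mono (by simp) hα2
  rw [alphaNorm_of_ne_top h]
  refine Real.one_le_rpow ?_ (by positivity)
  rw [← sum_sq_eq_one hu]
  refine Finset.sum_le_sum fun i _ => ?_
  rcases eq_or_ne (u i) 0 with h0 | h0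
  · simp [h0, Real.zero_rpow hp.ne']
  · rw [← Real.rpow_two]
    exact Real.rpow_le_rpow_of_exponent_ge (abs_pos.2 h0) (abs_le_one_of_norm_eq_one hu i) hp2

theorem alphaNorm_le_one (hα2 : 2 ≤ α) {u : EuclideanSpace ℝ (Fin d)}
    (hu : ‖u‖ = 1) : alphaNorm α u ≤ 1 := by
  by_cases h : α = ∞
  · subst h
    rw [alphaNorm_top_eq_norm]
    exact (pi_norm_le_iff_of_nonneg zero_le_one).2 (abs_le_one_of_norm_eq_one hu)
  · have hp2 : 2 ≤ α.toReal := by simpa using ENNReal.toReal_mono h hα2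
    rw [alphaNorm_of_ne_top h]
    refine Real.rpow_le_one (by positivity) ?_ (by positivity)
    rw [← sum_sq_eq_one hu]
    refine Finset.sum_le_sum fun i _ => ?_
    rw [← Real.rpow_two]
    rcases eq_or_ne (u i) 0 with h0 | h0
    · simp [h0, Real.zero_rpow (by linarith : α.toReal ≠ 0)]
    · exact Real.rpow_le_rpow_of_exponent_ge (abs_pos.2 h0) (abs_le_one_of_norm_eq_one hu i) hp2

/-- Power mean inequality with exponent `2/α ≥ 1` applied to the numbers `|uᵢ|^α`. -/
theorem alphaNorm_le_rpow [NeZero d] (hα : 0 < α) (hα2 : α ≤ 2) {u : EuclideanSpace ℝ (Fin d)}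
    (hu : ‖u‖ = 1) : (d : ℝ) ^ ((1 / 2 : ℝ) - (α⁻¹).toReal) * alphaNorm α u ≤ 1 := by
  have h : α ≠ ∞ := ne_top_of_le_ne_top (by simp) hα2
  have hp := ENNReal.toReal_pos hα.ne' h
  have hp2 : α.toReal ≤ 2 := by simpa using ENNReal.toReal_mono (by simp) hα2
  have hd : (0 : ℝ) < d := by exact_mod_cast NeZero.pos d
  rw [alphaNorm_of_ne_top h, ENNReal.toReal_inv]
  set p := α.toReal
  have key := Real.rpow_arith_mean_le_arith_mean_rpow Finset.univ (fun _ : Fin d => (d : ℝ)⁻¹)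
    (fun i => |u i| ^ p) (fun _ _ => by positivity) (by simp [hd.ne']) (fun _ _ => by positivity)
    (p := 2 / p) ((one_le_div hp).2 hp2)
  simp only [← Real.rpow_mul (abs_nonneg _), mul_div_cancel₀ _ hp.ne', Real.rpow_two,
    ← Finset.mul_sum, sum_sq_eq_one hu] at key
  set S := ∑ i, |u i| ^ p
  have hS : 0 ≤ S := by positivity
  rw [mul_one, Real.mul_rpow (by positivity) hS] at key
  have h2 : ((d : ℝ) ^ ((1 / 2 : ℝ) - p⁻¹) * S ^ (1 / p)) ^ 2 = d * ((d : ℝ)⁻¹ ^ (2 / p) * S ^ (2 / p)) := by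
    rw [mul_pow, ← Real.rpow_natCast, ← Real.rpow_natCast, ← Real.rpow_mul hd.le,
      ← Real.rpow_mul hS, Real.inv_rpow hd.le, ← Real.rpow_neg hd.le, ← mul_assoc,
      show (d : ℝ) * (d : ℝ) ^ (-(2 / p)) = (d : ℝ) ^ (1 + -(2 / p)) by
        rw [Real.rpow_add hd, Real.rpow_one]]
    congr 2 <;> push_cast <;> ring
  refine (sq_le_one_iff₀ (by positivity)).1 ?_
  rw [h2]
  calc (d : ℝ) * ((d : ℝ)⁻¹ ^ (2 / p) * S ^ (2 / p)) ≤ d * (d : ℝ)⁻¹ := by gcongr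
    _ = 1 := mul_inv_cancel₀ hd.ne'

/-- Power mean inequality with exponent `α/2 ≥ 1` applied to the numbers `|uᵢ|²`; for `α = ∞`, each
square is at most the largest one. -/
theorem one_le_rpow_mul_alphaNorm [NeZero d] (hα2 : 2 ≤ α) {u : EuclideanSpace ℝ (Fin d)}
    (hu : ‖u‖ = 1) : 1 ≤ (d : ℝ) ^ ((1 / 2 : ℝ) - (α⁻¹).toReal) * alphaNorm α u := by
  have hd : (0 : ℝ) < d := by exact_mod_cast NeZero.pos d
  by_cases h : α = ∞
  · subst h
    have h1 : (1 : ℝ) ≤ d * alphaNorm ∞ u ^ 2 := by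
      rw [← sum_sq_eq_one hu]
      calc ∑ i, |u i| ^ 2 ≤ ∑ _i : Fin d, alphaNorm ∞ u ^ 2 := by
            refine Finset.sum_le_sum fun i _ => ?_
            gcongr
            rw [alphaNorm_top_eq_norm]
            exact norm_le_pi_norm u.ofLp i
        _ = _ := by simp
    have h2 : ((d : ℝ) ^ ((1 / 2 : ℝ)) * alphaNorm ∞ u) ^ 2 = d * alphaNorm ∞ u ^ 2 := by
      rw [mul_pow, ← Real.rpow_natCast, ← Real.rpow_mul hd.le]
      norm_num
    rw [← h2] at h1
    have := alphaNorm_nonneg (α := ∞) u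
    simpa using (one_le_sq_iff₀ (by positivity)).1 h1
  · have hp2 : 2 ≤ α.toReal := by simpa using ENNReal.toReal_mono h hα2
    rw [alphaNorm_of_ne_top h, ENNReal.toReal_inv]
    set p := α.toReal
    have hp : 0 < p := by linarith
    have key := Real.rpow_arith_mean_le_arith_mean_rpow Finset.univ (fun _ : Fin d => (d : ℝ)⁻¹)
      (fun i => |u i| ^ 2) (fun _ _ => by positivity) (by simp [hd.ne']) (fun _ _ => by positivity)
      (p := p / 2) (by linarith)
    simp only [← Real.rpow_two, ← Real.rpow_mul (abs_nonneg _), mul_div_cancel₀ _ (two_ne_zero' ℝ),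
      ← Finset.mul_sum] at key
    simp only [Real.rpow_two, sum_sq_eq_one hu, mul_one] at key
    set S := ∑ i, |u i| ^ p
    have hS : 0 ≤ S := by positivity
    have h2 : ((d : ℝ) ^ ((1 / 2 : ℝ) - p⁻¹) * S ^ (1 / p)) ^ p = (d : ℝ) ^ (p / 2) * ((d : ℝ)⁻¹ * S) := by
      rw [Real.mul_rpow (by positivity) (by positivity), ← Real.rpow_mul hS,
        one_div_mul_cancel hp.ne', Real.rpow_one, ← Real.rpow_mul hd.le, ← mul_assoc,
        ← Real.rpow_neg_one (d : ℝ), ← Real.rpow_add hd]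
      congr 2
      field_simp
      ring
    by_contra! hlt
    have h3 := Real.rpow_lt_one (by positivity) hlt hp
    rw [h2] at h3
    have h4 : (d : ℝ) ^ (p / 2) * (d : ℝ)⁻¹ ^ (p / 2) = 1 := by
      rw [← Real.mul_rpow hd.le (by positivity), mul_inv_cancel₀ hd.ne', Real.one_rpow]
    have h5 : (d : ℝ) ^ (p / 2) * (d : ℝ)⁻¹ ^ (p / 2) ≤ (d : ℝ) ^ (p / 2) * ((d : ℝ)⁻¹ * S) := by
      gcongr
    linarith

end AlphaNorm

/-! ### One-dimensional projections and the absence of atoms. -/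

section Law

variable {α : ℝ≥0∞} {P : Measure (EuclideanSpace ℝ (Fin d))} [IsProbabilityMeasure P]

/-- Both characteristic functions at `s` equal `φ (|s| ‖u‖_α)`. -/
theorem IsAlphaSymmetric.map_inner (hP : IsAlphaSymmetric α P) (hα : 0 < α) (i : Fin d)
    (u : EuclideanSpace ℝ (Fin d)) :
    P.map (fun x => inner ℝ x u) = P.map (fun x => alphaNorm α u * x i) := by
  obtain ⟨φ, -, hφ⟩ := hP
  have hm (v : EuclideanSpace ℝ (Fin d)) (s : ℝ) :
      charFun (P.map (fun x => inner ℝ x v)) s = charFun P (s • v) := by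
    rw [charFun_apply, charFun_apply, integral_map (by fun_prop) (by fun_prop)]
    simp [inner_smul_right]
  have he : (fun x : EuclideanSpace ℝ (Fin d) => alphaNorm α u * x i) =
      fun x => inner ℝ x (alphaNorm α u • EuclideanSpace.single i (1 : ℝ)) := by
    ext x; simp [inner_smul_right, EuclideanSpace.inner_single_right]
  have := Measure.isProbabilityMeasure_map (μ := P)
    (f := fun x => inner ℝ x u) (by fun_prop)
  have := Measure.isProbabilityMeasure_map (μ := P)
    (f := fun x => inner ℝ x (alphaNorm α u • EuclideanSpace.single i (1 : ℝ))) (by fun_prop)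
  rw [he]
  refine Measure.ext_of_charFun ?_
  ext s
  rw [hm, hm, hφ, hφ, alphaNorm_smul hα, alphaNorm_smul hα, alphaNorm_smul hα,
    alphaNorm_single hα, mul_one, abs_of_nonneg (alphaNorm_nonneg u)]

theorem IsAlphaSymmetric.measure_inner_mem (hP : IsAlphaSymmetric α P) (hα : 0 < α) (i : Fin d)
    {u : EuclideanSpace ℝ (Fin d)} (hu : u ≠ 0) {B : Set ℝ} (hB : MeasurableSet B) :
    P {x | inner ℝ x u / alphaNorm α u ∈ B} = P {x | x i ∈ B} := by
  have h := congrArg (fun ν : Measure ℝ => ν ((fun t => t / alphaNorm α u) ⁻¹' B))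
    (hP.map_inner hα i u)
  have hB' : MeasurableSet ((fun t => t / alphaNorm α u) ⁻¹' B) := by
    exact hB.preimage (by fun_prop)
  simp only [Measure.map_apply (f := fun x : EuclideanSpace ℝ (Fin d) => inner ℝ x u)
    (by fun_prop) hB', Measure.map_apply (f := fun x : EuclideanSpace ℝ (Fin d) =>
      alphaNorm α u * x i) (by fun_prop) hB', Set.preimage_preimage,
      mul_div_cancel_left₀ _ (alphaNorm_pos hα hu).ne'] at h
  exact h

theorem IsAlphaSymmetric.measure_coord_neg_mem (hP : IsAlphaSymmetric α P) (hα : 0 < α)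
    (i : Fin d) {B : Set ℝ} (hB : MeasurableSet B) :
    P {x | -x i ∈ B} = P {x | x i ∈ B} := by
  rw [← hP.measure_inner_mem hα i (u := -EuclideanSpace.single i (1 : ℝ)) (by simp) hB]
  have h : alphaNorm α (-EuclideanSpace.single i (1 : ℝ)) = 1 := by
    rw [← neg_one_smul ℝ, alphaNorm_smul hα, alphaNorm_single hα]; simp
  simp [h, EuclideanSpace.inner_single_right]

/-- Fubini with Lebesgue measure in `u`: for `x ≠ 0` the hyperplane `xᗮ` is null, so `⟨X, u⟩ = 0`
has probability 0 for almost every `u`. This probability is the same for all `u ≠ 0`. -/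
theorem IsAlphaSymmetric.measure_coord_eq_zero (hP : IsAlphaSymmetric α P) (hα : 0 < α)
    (hP0 : P {0} = 0) (i : Fin d) : P {x | x i = 0} = 0 := by
  have hs : MeasurableSet {p : EuclideanSpace ℝ (Fin d) × EuclideanSpace ℝ (Fin d) |
      inner ℝ p.2 p.1 = (0 : ℝ)} :=
    (measurableSet_singleton (0 : ℝ)).preimage (by fun_prop :
      Measurable fun p : EuclideanSpace ℝ (Fin d) × EuclideanSpace ℝ (Fin d) =>
        (inner ℝ p.2 p.1 : ℝ))
  have h1 : (volume : Measure (EuclideanSpace ℝ (Fin d))).prod P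
      {p | inner ℝ p.2 p.1 = (0 : ℝ)} = 0 := by
    rw [Measure.prod_apply_symm hs, lintegral_eq_zero_iff (measurable_measure_prodMk_right hs)]
    have hne : ∀ᵐ x ∂P, x ≠ 0 := by
      rw [ae_iff]; simpa using hP0
    filter_upwards [hne] with x hx
    have hE : (fun u : EuclideanSpace ℝ (Fin d) => (u, x)) ⁻¹' {p | inner ℝ p.2 p.1 = (0 : ℝ)} =
        ((ℝ ∙ x)ᗮ : Submodule ℝ _) := by
      ext u
      simp [Submodule.mem_orthogonal_singleton_iff_inner_right]
    rw [hE]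
    refine Measure.addHaar_submodule _ _ fun htop => hx ?_
    have : x ∈ (ℝ ∙ x)ᗮ := htop ▸ Submodule.mem_top
    rwa [Submodule.mem_orthogonal_singleton_iff_inner_right, inner_self_eq_zero] at this
  have h2 := Measure.measure_ae_null_of_prod_null h1
  have : Nonempty (Fin d) := ⟨i⟩
  have h3 : ∀ᵐ u ∂(volume : Measure (EuclideanSpace ℝ (Fin d))), u ≠ 0 := by
    rw [ae_iff]; simp
  obtain ⟨u, hu, hu0⟩ := (h2.and h3).exists
  have h4 := hP.measure_inner_mem hα i hu0 (measurableSet_singleton 0)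
  simp only [Set.mem_singleton_iff] at h4
  rw [← h4]
  simpa [(alphaNorm_pos hα hu0).ne'] using hu

/-- The vector `eᵢ + s eⱼ`. -/
noncomputable def planeVec (i j : Fin d) (s : ℝ) : EuclideanSpace ℝ (Fin d) :=
  EuclideanSpace.single i (1 : ℝ) + s • EuclideanSpace.single j (1 : ℝ)

theorem inner_planeVec (i j : Fin d) (s : ℝ) (x : EuclideanSpace ℝ (Fin d)) :
    inner ℝ x (planeVec i j s) = x i + s * x j := by
  simp [planeVec, inner_add_right, inner_smul_right, EuclideanSpace.inner_single_right]

theorem planeVec_ne_zero {i j : Fin d} (hij : i ≠ j) (s : ℝ) : planeVec i j s ≠ 0 := by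
  intro h
  have := congrArg (fun v : EuclideanSpace ℝ (Fin d) => v i) h
  simp [planeVec, hij] at this

theorem continuous_planeVec (i j : Fin d) : Continuous (planeVec i j) := by
  unfold planeVec; fun_prop

/-- If the event had mass `m > 0` with `b ≠ 0`, projecting along `eᵢ + s eⱼ` would give `Xᵢ` an atom
of mass at least `m` at `h s`, for every `s`. Only finitely many such atoms exist, while `h` is
continuous and nonconstant, so its range is infinite. -/
theorem IsAlphaSymmetric.measure_two_coords_eq (hP : IsAlphaSymmetric α P) (hα : 0 < α)
    (hP0 : P {0} = 0) {i j : Fin d} (hij : i ≠ j) (a b : ℝ) :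
    P {x | x i = a ∧ x j = b} = 0 := by
  rcases eq_or_ne b 0 with rfl | hb
  · exact measure_mono_null (fun x hx => hx.2) (hP.measure_coord_eq_zero hα hP0 j)
  by_contra hm
  set m := P {x : EuclideanSpace ℝ (Fin d) | x i = a ∧ x j = b}
  have hfin := Measure.finite_const_le_meas_of_disjoint_iUnion P (pos_iff_ne_zero.2 hm)
    (As := fun r : ℝ => {x : EuclideanSpace ℝ (Fin d) | x i = r})
    (fun r => (measurableSet_singleton r).preimage (by fun_prop))
    (fun r s hrs => Set.disjoint_left.2 fun x hx hx' => hrs (hx.symm.trans hx')) (measure_ne_top _ _)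
  set h : ℝ → ℝ := fun s => (a + s * b) / alphaNorm α (planeVec i j s)
  have hpos s := alphaNorm_pos hα (planeVec_ne_zero hij s)
  have hcont : Continuous h := by
    refine Continuous.div (by fun_prop)
      ((continuous_alphaNorm hα).comp (continuous_planeVec i j)) fun s => (hpos s).ne'
  have hmem s : h s ∈ {r : ℝ | m ≤ P {x : EuclideanSpace ℝ (Fin d) | x i = r}} := by
    have := hP.measure_inner_mem hα i (planeVec_ne_zero hij s) (measurableSet_singleton (h s))
    simp only [Set.mem_singleton_iff] at this
    rw [Set.mem_ofPred_eq, ← this]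
    refine measure_mono fun x hx => ?_
    rw [Set.mem_ofPred_eq, inner_planeVec, hx.1, hx.2]
  have h0 : h (-a / b) = 0 := by simp [h, hb]
  have h1 : h (-a / b + 1) ≠ 0 := by
    have : a + (-a / b + 1) * b = b := by field_simp; ring
    simp only [h, this]
    exact div_ne_zero hb (hpos _).ne'
  refine (isPreconnected_univ.image h hcont.continuousOn).infinite_of_nontrivial
    ⟨_, ⟨_, trivial, h0⟩, _, ⟨_, trivial, rfl⟩, h1.symm⟩ (hfin.subset ?_)
  rintro _ ⟨s, -, rfl⟩
  exact hmem s

/-- An atom at `t` would give the same positive mass to each hyperplane `A s`. Two of them meet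
where `xᵢ` and `xⱼ` are both prescribed, a null set, so infinitely many almost disjoint sets would
share one positive mass. -/
theorem IsAlphaSymmetric.measure_coord_eq (hP : IsAlphaSymmetric α P) (hα : 0 < α)
    (hP0 : P {0} = 0) {i j : Fin d} (hij : i ≠ j) (t : ℝ) : P {x | x i = t} = 0 := by
  by_contra hm
  set A : ℝ → Set (EuclideanSpace ℝ (Fin d)) := fun s =>
    {x | inner ℝ x (planeVec i j s) / alphaNorm α (planeVec i j s) ∈ ({t} : Set ℝ)}
  have hA s : P (A s) = P {x | x i = t} :=
    hP.measure_inner_mem hα i (planeVec_ne_zero hij s) (measurableSet_singleton t)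
  have hfin := Measure.finite_const_le_meas_of_disjoint_iUnion₀ P (pos_iff_ne_zero.2 hm) (As := A)
    (fun s => ((measurableSet_singleton t).preimage (by fun_prop)).nullMeasurableSet)
    (fun r s hrs => ?_) (measure_ne_top _ _)
  · simp only [hA, le_refl, Set.ofPred_true] at hfin
    exact Set.infinite_univ hfin
  · set Nr := alphaNorm α (planeVec i j r)
    set Ns := alphaNorm α (planeVec i j s)
    have hr : Nr ≠ 0 := (alphaNorm_pos hα (planeVec_ne_zero hij r)).ne'
    have hs : Ns ≠ 0 := (alphaNorm_pos hα (planeVec_ne_zero hij s)).ne'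
    refine measure_mono_null ?_ (hP.measure_two_coords_eq hα hP0 hij
      (t * Nr - r * ((t * Nr - t * Ns) / (r - s))) ((t * Nr - t * Ns) / (r - s)))
    rintro x ⟨h1, h2⟩
    have h1' : x i + r * x j = t * Nr := by
      rw [← inner_planeVec, ← div_eq_iff hr]; exact h1
    have h2' : x i + s * x j = t * Ns := by
      rw [← inner_planeVec, ← div_eq_iff hs]; exact h2
    have h3 : x j = (t * Nr - t * Ns) / (r - s) := by
      rw [eq_div_iff (sub_ne_zero.2 hrs)]; linarith
    refine ⟨?_, h3⟩
    rw [← h3]; linarith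

end Law

/-! ### Continuity, symmetry and strict monotonicity of the marginal distribution function. -/

section MarginalCDF

theorem measureReal_coord_lt {P : Measure (EuclideanSpace ℝ (Fin d))} {i : Fin d}
    (h : ∀ t, P {x | x i = t} = 0) (t : ℝ) :
    P.real {x | x i < t} = marginalCDF P i t := by
  refine measureReal_congr ?_
  have : ∀ᵐ x ∂P, x i ≠ t := by rw [ae_iff]; simpa using h t
  filter_upwards [this] with x hx
  exact propext ⟨fun h : x i < t => h.le, fun h : x i ≤ t => lt_of_le_of_ne h hx⟩

variable {α : ℝ≥0∞} {P : Measure (EuclideanSpace ℝ (Fin d))} [IsProbabilityMeasure P]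

theorem marginalCDF_mono (i : Fin d) : Monotone (marginalCDF P i) := fun _ _ hst =>
  measureReal_mono fun _ hx => le_trans hx hst

theorem marginalCDF_eq_cdf (i : Fin d) (t : ℝ) :
    marginalCDF P i t = ProbabilityTheory.cdf (P.map fun x => x i) t := by
  have := Measure.isProbabilityMeasure_map (μ := P)
    (f := fun x : EuclideanSpace ℝ (Fin d) => x i) (by fun_prop)
  rw [ProbabilityTheory.cdf_eq_real, map_measureReal_apply (by fun_prop) measurableSet_Iic]
  rfl

theorem tendsto_marginalCDF_atTop (i : Fin d) : Tendsto (marginalCDF P i) atTop (𝓝 1) := by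
  rw [funext (marginalCDF_eq_cdf i)]
  exact ProbabilityTheory.tendsto_cdf_atTop _

theorem marginalCDF_le_one (i : Fin d) (t : ℝ) : marginalCDF P i t ≤ 1 := measureReal_le_one

theorem continuous_marginalCDF {i : Fin d} (h : ∀ t, P {x | x i = t} = 0) :
    Continuous (marginalCDF P i) := by
  have := Measure.isProbabilityMeasure_map (μ := P)
    (f := fun x : EuclideanSpace ℝ (Fin d) => x i) (by fun_prop)
  rw [continuous_iff_continuousAt]
  intro t
  rw [(marginalCDF_mono i).continuousAt_iff_leftLim_eq_rightLim, funext (marginalCDF_eq_cdf i),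
    StieltjesFunction.rightLim_eq]
  have h1 := (ProbabilityTheory.cdf (P.map fun x => x i)).measure_singleton t
  rw [ProbabilityTheory.measure_cdf, Measure.map_apply (by fun_prop) (measurableSet_singleton t)] at h1
  have h2 : P ((fun x : EuclideanSpace ℝ (Fin d) => x i) ⁻¹' {t}) = 0 := h t
  rw [h2, eq_comm, ENNReal.ofReal_eq_zero, sub_nonpos] at h1
  exact le_antisymm ((ProbabilityTheory.monotone_cdf _).leftLim_le le_rfl) h1

theorem IsAlphaSymmetric.measureReal_le_coord (hP : IsAlphaSymmetric α P) (hα : 0 < α)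
    (i : Fin d) (t : ℝ) : P.real {x | t ≤ x i} = marginalCDF P i (-t) := by
  have h := hP.measure_coord_neg_mem hα i (measurableSet_Iic (a := -t))
  simp only [Set.mem_Iic, neg_le_neg_iff] at h
  exact congrArg ENNReal.toReal h

theorem IsAlphaSymmetric.marginalCDF_neg (hP : IsAlphaSymmetric α P) (hα : 0 < α) {i : Fin d}
    (h : ∀ t, P {x | x i = t} = 0) (t : ℝ) : marginalCDF P i (-t) = 1 - marginalCDF P i t := by
  rw [← hP.measureReal_le_coord hα, ← measureReal_coord_lt h, ← probReal_compl_eq_one_sub]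
  · congr 1; ext x; simp
  · exact measurableSet_lt (by fun_prop) (by fun_prop)

theorem IsAlphaSymmetric.marginalCDF_zero (hP : IsAlphaSymmetric α P) (hα : 0 < α) {i : Fin d}
    (h : ∀ t, P {x | x i = t} = 0) : marginalCDF P i 0 = 1 / 2 := by
  have := hP.marginalCDF_neg hα h 0
  rw [neg_zero] at this
  linarith

/-- If `F` is flat on `(s, t]`, almost every `x` has no standardized projection in `(s, t]` along a
countable dense set of directions. The unit sphere is connected, so projections of an `x` with `xᵢ >
s` sweep continuously from `-xᵢ` to `xᵢ` and would enter `(s, t)`. Hence `Xᵢ ≤ s` almost surely. -/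
theorem IsAlphaSymmetric.marginalCDF_lt (hP : IsAlphaSymmetric α P) (hα : 0 < α) (hd : 1 < d)
    {i : Fin d} {s t : ℝ} (hs : 0 ≤ s) (hst : s < t) (h1 : marginalCDF P i s < 1) :
    marginalCDF P i s < marginalCDF P i t := by
  refine lt_of_le_of_ne (marginalCDF_mono i hst.le) fun heq => h1.ne ?_
  have : Nonempty (Fin d) := ⟨i⟩
  set S := Metric.sphere (0 : EuclideanSpace ℝ (Fin d)) 1
  have hS0 (u : S) : (u : EuclideanSpace ℝ (Fin d)) ≠ 0 := ne_zero_of_mem_unit_sphere u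
  let e : S := ⟨EuclideanSpace.single i 1, by simp [S]⟩
  have hSne : Nonempty S := ⟨e⟩
  have hconn : PreconnectedSpace S := by
    refine Subtype.preconnectedSpace (isPreconnected_sphere ?_ _ _)
    rw [← Module.finrank_eq_rank]
    simpa using hd
  have hnull : P {x : EuclideanSpace ℝ (Fin d) | x i ∈ Set.Ioc s t} = 0 := by
    rw [← measureReal_eq_zero_iff]
    have hE : {x : EuclideanSpace ℝ (Fin d) | x i ∈ Set.Ioc s t} = {x | x i ≤ t} \ {x | x i ≤ s} := by
      ext x; simp [and_comm]
    have hsub : {x : EuclideanSpace ℝ (Fin d) | x i ≤ s} ⊆ {x | x i ≤ t} :=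
      fun x hx => le_trans hx hst.le
    rw [hE, measureReal_sdiff hsub (measurableSet_le (by fun_prop) (by fun_prop))]
    exact sub_eq_zero.2 heq.symm
  have hae : ∀ᵐ x ∂P, ∀ n, inner ℝ x (TopologicalSpace.denseSeq S n : EuclideanSpace ℝ (Fin d)) /
      alphaNorm α (TopologicalSpace.denseSeq S n : EuclideanSpace ℝ (Fin d)) ∉ Set.Ioc s t := by
    rw [ae_all_iff]
    intro n
    rw [ae_iff]
    simpa only [not_not] using
      (hP.measure_inner_mem hα i (hS0 (TopologicalSpace.denseSeq S n)) measurableSet_Ioc).trans hnull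
  have hle : ∀ᵐ x ∂P, x i ≤ s := by
    filter_upwards [hae] with x hx
    by_contra! hlt
    set g : S → ℝ := fun u => inner ℝ x u.1 / alphaNorm α u.1
    have hg : Continuous g := by
      refine Continuous.div (by fun_prop) ((continuous_alphaNorm hα).comp continuous_subtype_val)
        fun u => (alphaNorm_pos hα (hS0 u)).ne'
    have hge : g e = x i := by
      simp [g, e, alphaNorm_single hα, EuclideanSpace.inner_single_right]
    have hgne : g (-e) = -x i := by
      have := alphaNorm_smul hα (-1) (e : EuclideanSpace ℝ (Fin d))
      simp only [neg_smul, one_smul, abs_neg, abs_one, one_mul] at this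
      rw [← hge]
      change inner ℝ x (-(e : EuclideanSpace ℝ (Fin d))) /
        alphaNorm α (-(e : EuclideanSpace ℝ (Fin d))) = -(inner ℝ x e.1 / alphaNorm α e.1)
      rw [inner_neg_right, this, neg_div]
    obtain ⟨r, hr1, hr2⟩ := exists_between (lt_min hst hlt)
    obtain ⟨u, hu⟩ : ∃ u, g u = r := by
      refine mem_range_of_exists_le_of_exists_ge hg ⟨-e, ?_⟩ ⟨e, ?_⟩
      · rw [hgne]; linarith
      · rw [hge]; exact hr2.le.trans (min_le_right _ _)
    obtain ⟨n, hn⟩ := (TopologicalSpace.denseRange_denseSeq S).exists_mem_open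
      (isOpen_Ioo.preimage hg : IsOpen (g ⁻¹' Set.Ioo s t))
      ⟨u, by rw [Set.mem_preimage, hu]; exact ⟨hr1, hr2.trans_le (min_le_left _ _)⟩⟩
    exact hx n ⟨hn.1, hn.2.le⟩
  exact (measureReal_congr (hle.mono fun x hx => propext ⟨fun _ => trivial, fun _ => hx⟩)).trans
    (probReal_univ (μ := P))

end MarginalCDF

/-! ### The halfspace median and slab probabilities. -/

section Median

variable {α : ℝ≥0∞} {P : Measure (EuclideanSpace ℝ (Fin d))} [IsProbabilityMeasure P]

theorem IsAlphaSymmetric.measureReal_inner_le (hP : IsAlphaSymmetric α P) (hα : 0 < α) (i : Fin d)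
    {u : EuclideanSpace ℝ (Fin d)} (hu : u ≠ 0) (t : ℝ) :
    P.real {x | inner ℝ x u ≤ t} = marginalCDF P i (t / alphaNorm α u) := by
  have h := hP.measure_inner_mem hα i hu (measurableSet_Iic (a := t / alphaNorm α u))
  simp only [Set.mem_Iic, div_le_div_iff_of_pos_right (alphaNorm_pos hα hu)] at h
  exact congrArg ENNReal.toReal h

theorem uniformBarycenter_singleton {ι : Type*} [Fintype ι] (x : EuclideanSpace ℝ ι) :
    uniformBarycenter {x} = x := by
  rw [uniformBarycenter, vectorSpan_singleton, finrank_bot, Nat.cast_zero, setAverage_eq,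
    Measure.restrict_singleton, measureReal_def, Measure.hausdorffMeasure_zero_singleton]
  simp

theorem bddBelow_range_measureReal {ι Ω : Type*} [MeasurableSpace Ω] (μ : Measure Ω)
    (s : ι → Set Ω) : BddBelow (Set.range fun i => μ.real (s i)) :=
  ⟨0, by rintro _ ⟨i, rfl⟩; exact measureReal_nonneg⟩

/-- The origin has depth `1/2`; at `x ≠ 0` the direction `-x/‖x‖` gives a strictly smaller
probability, so the median set is `{0}`. -/
theorem IsAlphaSymmetric.halfspaceMedian_eq_zero (hP : IsAlphaSymmetric α P) (hα : 0 < α)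
    (hd : 1 < d) {i : Fin d} (h : ∀ t, P {x | x i = t} = 0) : halfspaceMedian P = 0 := by
  have : Nonempty (Fin d) := ⟨i⟩
  have hSne : Nonempty (Metric.sphere (0 : EuclideanSpace ℝ (Fin d)) 1) :=
    ⟨⟨EuclideanSpace.single i 1, by simp⟩⟩
  have hhalf := hP.marginalCDF_zero hα h
  have h0 : halfspaceDepth P 0 = 1 / 2 := by
    simp [halfspaceDepth, hP.measureReal_inner_le hα i (ne_zero_of_mem_unit_sphere _), hhalf]
  have hlt {x : EuclideanSpace ℝ (Fin d)} (hx : x ≠ 0) : halfspaceDepth P x < 1 / 2 := by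
    have hx' : 0 < ‖x‖ := norm_pos_iff.2 hx
    let u : Metric.sphere (0 : EuclideanSpace ℝ (Fin d)) 1 :=
      ⟨-(‖x‖⁻¹ • x), by simp [norm_smul, hx'.ne']⟩
    have hu0 : (u : EuclideanSpace ℝ (Fin d)) ≠ 0 := ne_zero_of_mem_unit_sphere u
    refine (ciInf_le (bddBelow_range_measureReal _ _) u).trans_lt ?_
    rw [hP.measureReal_inner_le hα i hu0]
    have hin : inner ℝ x (u : EuclideanSpace ℝ (Fin d)) = -‖x‖ := by
      simp only [u, inner_neg_right, inner_smul_right, real_inner_self_eq_norm_sq]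
      field_simp
    have hpos := div_pos hx' (alphaNorm_pos hα hu0)
    have := hP.marginalCDF_lt hα hd le_rfl hpos (by rw [hhalf]; norm_num)
    rw [hin, neg_div, hP.marginalCDF_neg hα h]
    linarith
  have hS : halfspaceMedianSet P = {0} := by
    ext x
    constructor
    · intro hx
      by_contra hne
      exact absurd (hx (Set.mem_univ 0)) (not_le.2 (h0 ▸ hlt hne))
    · rintro rfl y -
      change halfspaceDepth P y ≤ halfspaceDepth P 0
      rcases eq_or_ne y 0 with rfl | hy
      · exact le_rfl
      · exact h0 ▸ (hlt hy).le
  rw [halfspaceMedian, hS, uniformBarycenter_singleton]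

theorem IsAlphaSymmetric.measureReal_abs_inner_le (hP : IsAlphaSymmetric α P) (hα : 0 < α)
    {i : Fin d} (h : ∀ t, P {x | x i = t} = 0) {u : EuclideanSpace ℝ (Fin d)} (hu : u ≠ 0) {r : ℝ}
    (hr : 0 ≤ r) :
    P.real {x | |inner ℝ x u| ≤ r} = 2 * marginalCDF P i (r / alphaNorm α u) - 1 := by
  have hN := alphaNorm_pos hα hu
  have h1 : P {x | |inner ℝ x u| ≤ r} = P {x | |x i| ≤ r / alphaNorm α u} := by
    have := hP.measure_inner_mem hα i hu (B := {y | |y| ≤ r / alphaNorm α u})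
      (measurableSet_le (by fun_prop) (by fun_prop))
    simpa only [Set.mem_ofPred_eq, abs_div, abs_of_pos hN, div_le_div_iff_of_pos_right hN] using this
  set t := r / alphaNorm α u
  have ht : 0 ≤ t := by positivity
  have hE : {x : EuclideanSpace ℝ (Fin d) | |x i| ≤ t} = {x | x i ≤ t} \ {x | x i < -t} := by
    ext x; simp [abs_le, and_comm]
  have hsub : {x : EuclideanSpace ℝ (Fin d) | x i < -t} ⊆ {x | x i ≤ t} := fun x hx => by
    simp only [Set.mem_ofPred_eq] at hx ⊢; linarith
  rw [measureReal_def, h1, ← measureReal_def, hE,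
    measureReal_sdiff hsub (measurableSet_lt (by fun_prop) (by fun_prop)),
    measureReal_coord_lt h, hP.marginalCDF_neg hα h]
  change marginalCDF P i t - _ = _
  ring

theorem IsAlphaSymmetric.measureReal_le_abs_inner (hP : IsAlphaSymmetric α P) (hα : 0 < α)
    {i : Fin d} (h : ∀ t, P {x | x i = t} = 0) {u : EuclideanSpace ℝ (Fin d)} (hu : u ≠ 0) {r : ℝ}
    (hr : 0 ≤ r) :
    P.real {x | r ≤ |inner ℝ x u|} = 2 - 2 * marginalCDF P i (r / alphaNorm α u) := by
  have hN := alphaNorm_pos hα hu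
  have hnull (t : ℝ) : P {x | inner ℝ x u = t} = 0 := by
    have h1 := hP.measure_inner_mem hα i hu (measurableSet_singleton (t / alphaNorm α u))
    simp only [Set.mem_singleton_iff, div_left_inj' hN.ne'] at h1
    rw [h1, h]
  have h2 : P.real {x | r ≤ |inner ℝ x u|} = P.real {x | |inner ℝ x u| ≤ r}ᶜ := by
    refine measureReal_congr ?_
    have h3 : ∀ᵐ x ∂P, inner ℝ x u ≠ r := by rw [ae_iff]; simpa using hnull r
    have h4 : ∀ᵐ x ∂P, inner ℝ x u ≠ -r := by rw [ae_iff]; simpa using hnull (-r)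
    filter_upwards [h3, h4] with x hx hx'
    refine propext ⟨fun hle : r ≤ |inner ℝ x u| => fun hge : |inner ℝ x u| ≤ r => ?_,
      fun hn : ¬ |inner ℝ x u| ≤ r => (not_le.1 hn).le⟩
    rcases (abs_eq hr).1 (le_antisymm hge hle) with he | he
    · exact hx he
    · exact hx' he
  rw [h2, probReal_compl_eq_one_sub (measurableSet_le (by fun_prop) (by fun_prop)),
    hP.measureReal_abs_inner_le hα h hu hr]
  ring

end Median

/-! ### Quadratic forms at sign vectors. -/

section SignVectors

variable {ι : Type*} [Fintype ι] [DecidableEq ι]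

/-- Flipping the sign of coordinate `i` permutes the sign vectors and negates the sum. -/
theorem sum_signs_mul_of_ne {i j : ι} (hij : i ≠ j) :
    ∑ ε : ι → ℤˣ, (((ε i : ℤ) : ℝ) * ((ε j : ℤ) : ℝ)) = 0 := by
  have h := Equiv.sum_comp (Equiv.mulLeft (Pi.mulSingle i (-1) : ι → ℤˣ))
    (fun ε : ι → ℤˣ => (((ε i : ℤ) : ℝ) * ((ε j : ℤ) : ℝ)))
  simp only [Equiv.coe_mulLeft, Pi.mul_apply, Pi.mulSingle_eq_same,
    Pi.mulSingle_eq_of_ne hij.symm] at h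
  simp only [neg_mul, one_mul, Units.val_neg, Int.cast_neg, Finset.sum_neg_distrib] at h
  linarith

theorem sum_signs_dotProduct_mulVec (M : Matrix ι ι ℝ) :
    ∑ ε : ι → ℤˣ, (fun i => ((ε i : ℤ) : ℝ)) ⬝ᵥ M.mulVec (fun i => ((ε i : ℤ) : ℝ)) =
      Fintype.card (ι → ℤˣ) * ∑ i, M i i := by
  have h (i j : ι) : ∑ ε : ι → ℤˣ, ((ε i : ℤ) : ℝ) * (M i j * ((ε j : ℤ) : ℝ)) =
      if i = j then Fintype.card (ι → ℤˣ) * M i i else 0 := by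
    split_ifs with hij
    · subst hij
      rw [Finset.sum_congr rfl (g := fun _ => M i i), Finset.sum_const, nsmul_eq_mul]
      · rfl
      · intro ε _
        rcases Int.units_eq_one_or (ε i) with h | h <;> simp [h]
    · rw [← mul_zero (M i j), ← sum_signs_mul_of_ne hij, Finset.mul_sum]
      exact Finset.sum_congr rfl fun _ _ => by ring
  simp only [dotProduct, Matrix.mulVec, Finset.mul_sum]
  rw [Finset.sum_comm]
  refine Finset.sum_congr rfl fun i _ => ?_
  rw [Finset.sum_comm]
  simp only [h, Finset.sum_ite_eq, Finset.mem_univ, if_true]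

/-- A symmetric matrix with nonpositive diagonal whose quadratic form is nonnegative at all sign
vectors vanishes. -/
theorem eq_zero_of_sign_dotProduct_nonneg {M : Matrix ι ι ℝ} (hM : M.IsSymm)
    (hdiag : ∀ i, M i i ≤ 0)
    (hsign : ∀ w : ι → ℝ, (∀ i, |w i| = 1) → 0 ≤ w ⬝ᵥ M.mulVec w) : M = 0 := by
  have habs (ε : ι → ℤˣ) (i : ι) : |((ε i : ℤ) : ℝ)| = 1 := by
    rcases Int.units_eq_one_or (ε i) with h | h <;> simp [h]
  have hcard : (0 : ℝ) < Fintype.card (ι → ℤˣ) := by exact_mod_cast Fintype.card_pos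
  have hsum := sum_signs_dotProduct_mulVec M
  -- The average of the form over sign vectors is the trace, which is therefore both nonnegative and
  -- nonpositive.
  have htr : ∑ i, M i i = 0 := by
    refine le_antisymm (Finset.sum_nonpos fun i _ => hdiag i) ?_
    refine nonneg_of_mul_nonneg_right (hsum ▸ ?_) hcard
    exact Finset.sum_nonneg fun ε _ => hsign _ (habs ε)
  have hd0 i : M i i = 0 :=
    (Finset.sum_eq_zero_iff_of_nonpos fun i _ => hdiag i).1 htr i (Finset.mem_univ i)
  rw [htr, mul_zero, Finset.sum_eq_zero_iff_of_nonneg fun ε _ => hsign _ (habs ε)] at hsum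
  have hq (w : ι → ℝ) (ε : ι → ℤˣ) (hw : ∀ i, w i = ((ε i : ℤ) : ℝ)) : w ⬝ᵥ M.mulVec w = 0 := by
    rw [funext hw]; exact hsum ε (Finset.mem_univ ε)
  ext k l
  rcases eq_or_ne k l with rfl | hkl
  · exact hd0 k
  -- The form now vanishes at every sign vector. Its mixed second difference under flipping
  -- coordinates `k` and `l` of the all-ones vector is `8 M k l`.
  have h1 := hq 1 1 (by simp)
  have h2 := hq (1 - (2 : ℝ) • Pi.single k 1) (Pi.mulSingle k (-1)) fun i => by
    rcases eq_or_ne i k with rfl | hi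
    · simp; norm_num
    · simp [hi]
  have h3 := hq (1 - (2 : ℝ) • Pi.single l 1) (Pi.mulSingle l (-1)) fun i => by
    rcases eq_or_ne i l with rfl | hi
    · simp; norm_num
    · simp [hi]
  have h4 := hq (1 - (2 : ℝ) • Pi.single k 1 - (2 : ℝ) • Pi.single l 1)
    (Pi.mulSingle k (-1) * Pi.mulSingle l (-1)) fun i => by
    rcases eq_or_ne i k with rfl | hi
    · simp [hkl]; norm_num
    · rcases eq_or_ne i l with rfl | hi'
      · simp [hi]; norm_num
      · simp [hi, hi']
  have hs := hM.apply k l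
  simp only [Matrix.mulVec_sub, Matrix.mulVec_smul, dotProduct_sub, sub_dotProduct, smul_dotProduct,
    dotProduct_smul, single_one_dotProduct, Matrix.mulVec_single_one, Matrix.col_apply,
    smul_eq_mul] at h1 h2 h3 h4
  rw [Matrix.zero_apply]
  linarith

end SignVectors

/-! ### The scatter depth in terms of `F`, and the balance equation. -/

section Depth

theorem sqrtQuadForm_nonneg (S : Matrix (Fin d) (Fin d) ℝ) (u : EuclideanSpace ℝ (Fin d)) :
    0 ≤ sqrtQuadForm S u := Real.sqrt_nonneg _

theorem sqrtQuadForm_smul_one {σ : ℝ} (hσ : 0 ≤ σ) (u : EuclideanSpace ℝ (Fin d)) :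
    sqrtQuadForm (σ ^ 2 • (1 : Matrix (Fin d) (Fin d) ℝ)) u = σ * ‖u‖ := by
  have : u.ofLp ⬝ᵥ u.ofLp = ‖u‖ ^ 2 := by
    rw [EuclideanSpace.norm_sq_eq]; simp [dotProduct, sq]
  rw [sqrtQuadForm, Matrix.smul_mulVec, Matrix.one_mulVec, dotProduct_smul, this, smul_eq_mul,
    ← mul_pow, Real.sqrt_sq (by positivity)]

theorem sqrtQuadForm_single (S : Matrix (Fin d) (Fin d) ℝ) (i : Fin d) :
    sqrtQuadForm S (EuclideanSpace.single i 1) = √(S i i) := by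
  simp [sqrtQuadForm]

theorem sqrtQuadForm_smul (S : Matrix (Fin d) (Fin d) ℝ) {r : ℝ} (hr : 0 ≤ r)
    (u : EuclideanSpace ℝ (Fin d)) : sqrtQuadForm S (r • u) = r * sqrtQuadForm S u := by
  simp only [sqrtQuadForm, WithLp.ofLp_smul, Matrix.mulVec_smul, dotProduct_smul, smul_dotProduct,
    smul_eq_mul]
  rw [← mul_assoc, Real.sqrt_mul (by positivity), Real.sqrt_mul_self hr]

variable {α : ℝ≥0∞} {P : Measure (EuclideanSpace ℝ (Fin d))} [IsProbabilityMeasure P]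

theorem IsAlphaSymmetric.scatterDepth_eq (hP : IsAlphaSymmetric α P) (hα : 0 < α)
    (hd : 1 < d) {i : Fin d} (h : ∀ t, P {x | x i = t} = 0) (S : Matrix (Fin d) (Fin d) ℝ) :
    scatterDepth P S = ⨅ u : Metric.sphere (0 : EuclideanSpace ℝ (Fin d)) 1,
      min (2 * marginalCDF P i (sqrtQuadForm S u.1 / alphaNorm α u.1) - 1)
        (2 - 2 * marginalCDF P i (sqrtQuadForm S u.1 / alphaNorm α u.1)) := by
  simp only [scatterDepth, hP.halfspaceMedian_eq_zero hα hd h, sub_zero]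
  refine iInf_congr fun u => ?_
  have hu : u.1 ≠ 0 := ne_zero_of_mem_unit_sphere u
  rw [hP.measureReal_abs_inner_le hα h hu (sqrtQuadForm_nonneg S _),
    hP.measureReal_le_abs_inner hα h hu (sqrtQuadForm_nonneg S _)]

theorem scatterDepth_le (P : Measure (EuclideanSpace ℝ (Fin d)))
    (S : Matrix (Fin d) (Fin d) ℝ) (u : Metric.sphere (0 : EuclideanSpace ℝ (Fin d)) 1) :
    scatterDepth P S ≤
      min (P.real {x | |inner ℝ (x - halfspaceMedian P) u.1| ≤ sqrtQuadForm S u.1})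
        (P.real {x | sqrtQuadForm S u.1 ≤ |inner ℝ (x - halfspaceMedian P) u.1|}) :=
  ciInf_le ⟨0, by rintro _ ⟨u, rfl⟩; exact le_min measureReal_nonneg measureReal_nonneg⟩ u

theorem IsAlphaSymmetric.scatterDepth_le (hP : IsAlphaSymmetric α P) (hα : 0 < α)
    (hd : 1 < d) {i : Fin d} (h : ∀ t, P {x | x i = t} = 0) (S : Matrix (Fin d) (Fin d) ℝ)
    {u : EuclideanSpace ℝ (Fin d)} (hu : ‖u‖ = 1) :
    scatterDepth P S ≤ 2 * marginalCDF P i (sqrtQuadForm S u / alphaNorm α u) - 1 ∧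
      scatterDepth P S ≤ 2 - 2 * marginalCDF P i (sqrtQuadForm S u / alphaNorm α u) := by
  have hu0 : u ≠ 0 := by rintro rfl; simp at hu
  have := ScatterDepth.scatterDepth_le P S ⟨u, by simpa using hu⟩
  simp only [hP.halfspaceMedian_eq_zero hα hd h, sub_zero] at this
  rwa [hP.measureReal_abs_inner_le hα h hu0 (sqrtQuadForm_nonneg S _),
    hP.measureReal_le_abs_inner hα h hu0 (sqrtQuadForm_nonneg S _), le_min_iff] at this

/-- Superlevel sets of the scatter depth, in terms of the standardized scale in each direction. -/
theorem IsAlphaSymmetric.le_scatterDepth_iff (hP : IsAlphaSymmetric α P) (hα : 0 < α)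
    (hd : 1 < d) {i : Fin d} (h : ∀ t, P {x | x i = t} = 0) (S : Matrix (Fin d) (Fin d) ℝ)
    {lo hi m : ℝ} (hhi : 0 ≤ hi) (hlo1 : marginalCDF P i lo < 1) (hhi1 : marginalCDF P i hi < 1)
    (hmlo : m = 2 * marginalCDF P i lo - 1) (hmhi : m = 2 - 2 * marginalCDF P i hi) :
    m ≤ scatterDepth P S ↔ ∀ u : EuclideanSpace ℝ (Fin d), ‖u‖ = 1 →
      lo ≤ sqrtQuadForm S u / alphaNorm α u ∧ sqrtQuadForm S u / alphaNorm α u ≤ hi := by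
  constructor
  · intro hm u hu
    have h1 := hP.scatterDepth_le hα hd h S hu
    constructor
    · by_contra! hlt
      have := hP.marginalCDF_lt hα hd (div_nonneg (sqrtQuadForm_nonneg S _) (alphaNorm_nonneg u)) hlt
        ((marginalCDF_mono i hlt.le).trans_lt hlo1)
      linarith [h1.1]
    · by_contra! hlt
      have := hP.marginalCDF_lt hα hd hhi hlt hhi1
      linarith [h1.2]
  · intro hS
    have hSne : Nonempty (Metric.sphere (0 : EuclideanSpace ℝ (Fin d)) 1) :=
      ⟨⟨EuclideanSpace.single i 1, by simp⟩⟩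
    rw [hP.scatterDepth_eq hα hd h]
    refine le_ciInf fun u => ?_
    obtain ⟨h1, h2⟩ := hS u.1 (by simp)
    have := marginalCDF_mono (P := P) i h1
    have := marginalCDF_mono (P := P) i h2
    exact le_min (by linarith) (by linarith)

/-- The equation reads `F (s * c) + F s = 3/2`, and the left side grows continuously from 1 at `s =
0` to the limit 2. For uniqueness, two values summing to `3/2` cannot both be 1, so at least one
summand is still strictly increasing at a solution. -/
theorem exists_scale {F : ℝ → ℝ} (hmono : Monotone F) (hcont : Continuous F) (h0 : F 0 = 1 / 2)
    (hlim : Tendsto F atTop (𝓝 1)) (hle : ∀ t, F t ≤ 1)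
    (hlt : ∀ s t, 0 ≤ s → s < t → F s < 1 → F s < F t) {c : ℝ} (hc : 0 < c) :
    ∃ σ : ℝ, 0 < σ ∧ ∀ s : ℝ, F (s * c) - 1 / 2 = 1 - F s ↔ s = σ := by
  set g : ℝ → ℝ := fun s => F (s * c) + F s
  have hg : Continuous g := by fun_prop
  have hgm : Monotone g := fun s t hst =>
    add_le_add (hmono (mul_le_mul_of_nonneg_right hst hc.le)) (hmono hst)
  have hg0 : g 0 = 1 := by simp [g, h0]; norm_num
  have hglim : Tendsto g atTop (𝓝 (1 + 1)) :=
    (hlim.comp (tendsto_id.atTop_mul_const hc)).add hlim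
  obtain ⟨b, hb⟩ := (hglim.eventually (lt_mem_nhds (by norm_num : (3 / 2 : ℝ) < 1 + 1))).exists
  obtain ⟨σ, hσ⟩ : ∃ σ, g σ = 3 / 2 :=
    mem_range_of_exists_le_of_exists_ge hg ⟨0, by rw [hg0]; norm_num⟩ ⟨b, hb.le⟩
  have hpos {s : ℝ} (hs : g s = 3 / 2) : 0 < s := by
    by_contra! h
    have := hgm h
    linarith
  have hne {s t : ℝ} (hs : g s = 3 / 2) (ht : g t = 3 / 2) : ¬ s < t := fun hst => by
    have hs0 := hpos hs
    have h1 := hmono hst.le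
    have h2 := hmono (mul_le_mul_of_nonneg_right hst.le hc.le)
    have h3 : F s = F t := by simp only [g] at hs ht; linarith
    have h4 : F (s * c) = F (t * c) := by simp only [g] at hs ht; linarith
    rcases (hle s).lt_or_eq with h5 | h5
    · exact (hlt s t hs0.le hst h5).ne h3
    · refine (hlt (s * c) (t * c) (by positivity) (by gcongr) ?_).ne h4
      simp only [g] at hs; linarith
  refine ⟨σ, hpos hσ, fun s => ⟨fun hs => ?_, ?_⟩⟩
  · have hs' : g s = 3 / 2 := by simp only [g]; linarith
    exact le_antisymm (not_lt.1 (hne hσ hs')) (not_lt.1 (hne hs' hσ))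
  · rintro rfl
    simp only [g] at hσ; linarith

end Depth

/-! ### Extremal directions and the uniqueness of the maximizer. -/

section Extremal

variable {α : ℝ≥0∞}

/-- Vectors with coordinates of equal modulus are the equality case of the power mean inequality. -/
theorem rpow_inv_sub_half_mul_alphaNorm [NeZero d] (hα : 0 < α) {w : EuclideanSpace ℝ (Fin d)}
    (hw : ∀ i, |w i| = 1) :
    (d : ℝ) ^ ((1 / 2 : ℝ) - (α⁻¹).toReal) * alphaNorm α ((√d)⁻¹ • w) = 1 := by
  have hd : (0 : ℝ) < d := by exact_mod_cast NeZero.pos d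
  rw [alphaNorm_smul hα, alphaNorm_of_abs_eq hα zero_le_one hw, abs_of_nonneg (by positivity),
    mul_one, Real.sqrt_eq_rpow, ← Real.rpow_neg hd.le, ← Real.rpow_add hd, ← Real.rpow_add hd]
  ring_nf
  exact Real.rpow_zero _

theorem norm_smul_sign [NeZero d] {w : EuclideanSpace ℝ (Fin d)}
    (hw : ∀ i, |w i| = 1) : ‖(√d)⁻¹ • w‖ = 1 := by
  have hd : (0 : ℝ) < d := by exact_mod_cast NeZero.pos d
  rw [norm_smul, EuclideanSpace.norm_eq]
  simp [hw, abs_of_nonneg, hd.ne']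

theorem sqrtQuadForm_div_alphaNorm_sign [NeZero d] (hα : 0 < α) (S : Matrix (Fin d) (Fin d) ℝ)
    {w : EuclideanSpace ℝ (Fin d)} (hw : ∀ i, |w i| = 1) :
    sqrtQuadForm S ((√d)⁻¹ • w) / alphaNorm α ((√d)⁻¹ • w) =
      √((w.ofLp ⬝ᵥ S.mulVec w.ofLp) / d) * (d : ℝ) ^ ((1 / 2 : ℝ) - (α⁻¹).toReal) := by
  have h := rpow_inv_sub_half_mul_alphaNorm hα hw
  rw [div_eq_iff (right_ne_zero_of_mul_eq_one h), mul_assoc, h, mul_one,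
    sqrtQuadForm_smul _ (by positivity), sqrtQuadForm, Real.sqrt_div' _ (Nat.cast_nonneg d),
    div_eq_inv_mul]

theorem dotProduct_sq_smul_one_of_sign {w : Fin d → ℝ} (hw : ∀ i, |w i| = 1) (r : ℝ) :
    w ⬝ᵥ (r • (1 : Matrix (Fin d) (Fin d) ℝ)).mulVec w = d * r := by
  have : w ⬝ᵥ w = d := by
    simp only [dotProduct, ← abs_mul_abs_self (w _), hw]
    simp
  rw [Matrix.smul_mulVec, Matrix.one_mulVec, dotProduct_smul, this, smul_eq_mul, mul_comm]

/-- A positive definite matrix whose standardized scales lie between `σ d^(1/2 - 1/α)` and `σ` is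
`σ² I`. -/
theorem eq_smul_one_of_le_of_le [NeZero d] (hα : 0 < α) {S : Matrix (Fin d) (Fin d) ℝ}
    (hS : S.PosDef) {σ : ℝ} (hσ : 0 < σ)
    (h : ∀ u : EuclideanSpace ℝ (Fin d), ‖u‖ = 1 →
      σ * (d : ℝ) ^ ((1 / 2 : ℝ) - (α⁻¹).toReal) ≤ sqrtQuadForm S u / alphaNorm α u ∧
        sqrtQuadForm S u / alphaNorm α u ≤ σ) :
    S = σ ^ 2 • (1 : Matrix (Fin d) (Fin d) ℝ) := by
  have hd : (0 : ℝ) < d := by exact_mod_cast NeZero.pos d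
  have hsymm : S.IsSymm :=
    (Matrix.conjTranspose_eq_transpose_of_trivial S).symm.trans hS.isHermitian
  refine sub_eq_zero.1 (eq_zero_of_sign_dotProduct_nonneg
    (hsymm.sub (Matrix.isSymm_one.smul _)) (fun i => ?_) fun w hw => ?_)
  · have h1 := (h (EuclideanSpace.single i 1) (by simp)).2
    rw [sqrtQuadForm_single, alphaNorm_single hα, div_one, Real.sqrt_le_left hσ.le] at h1
    simpa using h1
  · have h1 := (h ((√d)⁻¹ • WithLp.toLp 2 w) (norm_smul_sign hw)).1
    rw [sqrtQuadForm_div_alphaNorm_sign hα S hw, mul_le_mul_iff_left₀ (by positivity),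
      Real.le_sqrt' hσ, le_div_iff₀' hd] at h1
    rw [Matrix.sub_mulVec, dotProduct_sub, dotProduct_sq_smul_one_of_sign hw, sub_nonneg]
    exact h1

/-- A positive definite matrix whose standardized scales lie between `σ` and `σ d^(1/2 - 1/α)` is
`σ² I`. -/
theorem eq_smul_one_of_le_of_le' [NeZero d] (hα : 0 < α) {S : Matrix (Fin d) (Fin d) ℝ}
    (hS : S.PosDef) {σ : ℝ} (hσ : 0 < σ)
    (h : ∀ u : EuclideanSpace ℝ (Fin d), ‖u‖ = 1 →
      σ ≤ sqrtQuadForm S u / alphaNorm α u ∧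
        sqrtQuadForm S u / alphaNorm α u ≤ σ * (d : ℝ) ^ ((1 / 2 : ℝ) - (α⁻¹).toReal)) :
    S = σ ^ 2 • (1 : Matrix (Fin d) (Fin d) ℝ) := by
  have hd : (0 : ℝ) < d := by exact_mod_cast NeZero.pos d
  have hsymm : S.IsSymm :=
    (Matrix.conjTranspose_eq_transpose_of_trivial S).symm.trans hS.isHermitian
  -- The inequalities are reversed here, so the sign-vector lemma is applied to `σ² I - S` instead
  -- of `S - σ² I`.
  refine (sub_eq_zero.1 (eq_zero_of_sign_dotProduct_nonneg
    ((Matrix.isSymm_one.smul _).sub hsymm) (fun i => ?_) fun w hw => ?_)).symm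
  · have h1 := (h (EuclideanSpace.single i 1) (by simp)).1
    rw [sqrtQuadForm_single, alphaNorm_single hα, div_one, Real.le_sqrt' hσ] at h1
    simpa using h1
  · have h1 := (h ((√d)⁻¹ • WithLp.toLp 2 w) (norm_smul_sign hw)).2
    rw [sqrtQuadForm_div_alphaNorm_sign hα S hw, mul_le_mul_iff_left₀ (by positivity),
      Real.sqrt_le_left hσ.le, div_le_iff₀' hd] at h1
    rw [Matrix.sub_mulVec, dotProduct_sub, dotProduct_sq_smul_one_of_sign hw, sub_nonneg]
    exact h1

variable {P : Measure (EuclideanSpace ℝ (Fin d))} [IsProbabilityMeasure P]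

/-- At the scale `σ` solving the balance equation, `σ² I` has scatter depth `m`, and it is the only
positive definite matrix of scatter depth at least `m`. -/
theorem IsAlphaSymmetric.scatterDepth_smul_one (hP : IsAlphaSymmetric α P) (hα : 0 < α)
    (hd : 1 < d) {i : Fin d} (h : ∀ t, P {x | x i = t} = 0) {σ c m : ℝ} (hσ : 0 < σ)
    (hc : c = (d : ℝ) ^ ((1 / 2 : ℝ) - (α⁻¹).toReal))
    (hbal : marginalCDF P i (σ * c) - 1 / 2 = 1 - marginalCDF P i σ)
    (hm : (α ≤ 2 ∧ m = 2 * marginalCDF P i (σ * c) - 1) ∨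
      (2 ≤ α ∧ m = 2 * marginalCDF P i σ - 1)) :
    scatterDepth P (σ ^ 2 • (1 : Matrix (Fin d) (Fin d) ℝ)) = m ∧
      ∀ S : Matrix (Fin d) (Fin d) ℝ, S.PosDef → m ≤ scatterDepth P S →
        S = σ ^ 2 • (1 : Matrix (Fin d) (Fin d) ℝ) := by
  have : NeZero d := ⟨by omega⟩
  have hd0 : (0 : ℝ) < d := by exact_mod_cast NeZero.pos d
  have hcpos : 0 < c := hc ▸ Real.rpow_pos_of_pos hd0 _
  have hhalf := hP.marginalCDF_zero hα h
  have hgt {s : ℝ} (hs : 0 < s) : 1 / 2 < marginalCDF P i s := by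
    have := hP.marginalCDF_lt hα hd le_rfl hs (by rw [hhalf]; norm_num)
    rwa [hhalf] at this
  -- The two values sum to `3/2` and each exceeds `1/2`, so neither reaches 1.
  have hσ1 : marginalCDF P i σ < 1 := by linarith [hgt (mul_pos hσ hcpos)]
  have hσc1 : marginalCDF P i (σ * c) < 1 := by linarith [hgt hσ]
  -- In a coordinate direction the standardized scale of `σ² I` is exactly `σ`, which caps its depth
  -- at `m`.
  have hup := hP.scatterDepth_le hα hd h (σ ^ 2 • (1 : Matrix (Fin d) (Fin d) ℝ))
    (u := EuclideanSpace.single i 1) (by simp)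
  rw [sqrtQuadForm_smul_one hσ.le, alphaNorm_single hα, PiLp.norm_single, norm_one,
    mul_one, div_one] at hup
  have hnorm {u : EuclideanSpace ℝ (Fin d)} (hu : ‖u‖ = 1) : 0 < alphaNorm α u :=
    alphaNorm_pos hα (by rintro rfl; simp at hu)
  -- The two cases differ in which of `σ` and `σ * c` is the lower endpoint: `c ≤ 1` for `α ≤ 2` and
  -- `c ≥ 1` for `α ≥ 2`.
  rcases hm with ⟨hα2, hm⟩ | ⟨hα2, hm⟩
  · have hiff S := hP.le_scatterDepth_iff hα hd h S (lo := σ * c) (hi := σ) (m := m)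
      hσ.le hσc1 hσ1 hm (by linarith)
    refine ⟨le_antisymm (by linarith [hup.2]) ((hiff _).2 fun u hu => ?_), fun S hS hmS =>
      eq_smul_one_of_le_of_le hα hS hσ (hc ▸ (hiff S).1 hmS)⟩
    have h1 := one_le_alphaNorm hα hα2 hu
    have h2 := alphaNorm_le_rpow hα hα2 hu
    rw [← hc] at h2
    rw [sqrtQuadForm_smul_one hσ.le, hu, mul_one, le_div_iff₀ (hnorm hu), div_le_iff₀ (hnorm hu),
      mul_assoc]
    exact ⟨mul_le_of_le_one_right hσ.le h2, le_mul_of_one_le_right hσ.le h1⟩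
  · have hiff S := hP.le_scatterDepth_iff hα hd h S (lo := σ) (hi := σ * c) (m := m)
      (by positivity) hσ1 hσc1 hm (by linarith)
    refine ⟨le_antisymm (by linarith [hup.1]) ((hiff _).2 fun u hu => ?_), fun S hS hmS =>
      eq_smul_one_of_le_of_le' hα hS hσ (hc ▸ (hiff S).1 hmS)⟩
    have h1 := alphaNorm_le_one hα2 hu
    have h2 := one_le_rpow_mul_alphaNorm hα2 hu
    rw [← hc] at h2
    rw [sqrtQuadForm_smul_one hσ.le, hu, mul_one, le_div_iff₀ (hnorm hu), div_le_iff₀ (hnorm hu),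
      mul_assoc]
    exact ⟨mul_le_of_le_one_right hσ.le h1, le_mul_of_one_le_right hσ.le h2⟩

end Extremal

end ScatterDepth


/-! ### The main theorem. -/

theorem mainTheorem3 (d : ℕ) (hd : 1 < d) (α : ℝ≥0∞) (hα : 0 < α)
    (P : Measure (EuclideanSpace ℝ (Fin d))) [IsProbabilityMeasure P]
    (hP : ScatterDepth.IsAlphaSymmetric α P) (hP0 : P {0} = 0)
    (F : ℝ → ℝ) (hF : F = ScatterDepth.marginalCDF P ⟨0, Nat.zero_lt_of_lt hd⟩)
    (c : ℝ) (hc : c = (d : ℝ) ^ ((1 / 2 : ℝ) - (α⁻¹).toReal)) :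
    ∃ σ : ℝ, 0 < σ ∧
      (∀ s : ℝ, F (s * c) - 1 / 2 = 1 - F s ↔ s = σ) ∧
      ScatterDepth.scatterMedianSet P = {σ ^ 2 • (1 : Matrix (Fin d) (Fin d) ℝ)} ∧
      ScatterDepth.scatterMedianMatrix P = σ ^ 2 • (1 : Matrix (Fin d) (Fin d) ℝ) ∧
      IsGreatest (ScatterDepth.scatterDepth P '' {S | S.PosDef})
        (ScatterDepth.scatterDepth P (σ ^ 2 • (1 : Matrix (Fin d) (Fin d) ℝ))) ∧
      (α ≤ 2 →
        ScatterDepth.scatterDepth P (σ ^ 2 • (1 : Matrix (Fin d) (Fin d) ℝ)) = 2 * F (σ * c) - 1 ∧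
        ScatterDepth.scatterDepth P (σ ^ 2 • (1 : Matrix (Fin d) (Fin d) ℝ)) = 2 - 2 * F σ) ∧
      (2 ≤ α →
        ScatterDepth.scatterDepth P (σ ^ 2 • (1 : Matrix (Fin d) (Fin d) ℝ)) = 2 * F σ - 1 ∧
        ScatterDepth.scatterDepth P (σ ^ 2 • (1 : Matrix (Fin d) (Fin d) ℝ)) =
          2 - 2 * F (σ * c)) := by
  have hij : (⟨0, Nat.zero_lt_of_lt hd⟩ : Fin d) ≠ ⟨1, hd⟩ := by simp
  set i : Fin d := ⟨0, Nat.zero_lt_of_lt hd⟩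
  have h : ∀ t : ℝ, P {x | x i = t} = 0 := hP.measure_coord_eq hα hP0 hij
  have hcpos : 0 < c :=
    hc ▸ Real.rpow_pos_of_pos (by exact_mod_cast Nat.zero_lt_of_lt hd) _
  subst hF
  obtain ⟨σ, hσ, huniq⟩ := ScatterDepth.exists_scale (ScatterDepth.marginalCDF_mono i)
    (ScatterDepth.continuous_marginalCDF h) (hP.marginalCDF_zero hα h)
    (ScatterDepth.tendsto_marginalCDF_atTop i) (ScatterDepth.marginalCDF_le_one i)
    (fun s t hs hst h1 => hP.marginalCDF_lt hα hd hs hst h1) hcpos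
  have hbal := (huniq σ).2 rfl
  have key {m : ℝ} := hP.scatterDepth_smul_one hα hd h (m := m) hσ hc hbal
  obtain ⟨m, hdep, hmax⟩ : ∃ m,
      ScatterDepth.scatterDepth P (σ ^ 2 • (1 : Matrix (Fin d) (Fin d) ℝ)) = m ∧
      ∀ S : Matrix (Fin d) (Fin d) ℝ, S.PosDef → m ≤ ScatterDepth.scatterDepth P S →
        S = σ ^ 2 • (1 : Matrix (Fin d) (Fin d) ℝ) := by
    rcases le_total α 2 with hα2 | hα2
    · exact ⟨_, key (Or.inl ⟨hα2, rfl⟩)⟩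
    · exact ⟨_, key (Or.inr ⟨hα2, rfl⟩)⟩
  subst hdep
  have hpd : (σ ^ 2 • (1 : Matrix (Fin d) (Fin d) ℝ)).PosDef := Matrix.PosDef.one.smul (by positivity)
  have hle (S : Matrix (Fin d) (Fin d) ℝ) (hS : S.PosDef) : ScatterDepth.scatterDepth P S ≤
      ScatterDepth.scatterDepth P (σ ^ 2 • (1 : Matrix (Fin d) (Fin d) ℝ)) := by
    -- Maximality follows from uniqueness: a strictly deeper matrix would have to be `σ² I` itself.
    by_contra! hlt
    exact hlt.ne (by rw [hmax S hS hlt.le])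
  have hset : ScatterDepth.scatterMedianSet P = {σ ^ 2 • (1 : Matrix (Fin d) (Fin d) ℝ)} := by
    ext S
    constructor
    · rintro ⟨hS, hSmax⟩
      exact hmax S hS (hSmax hpd)
    · rintro rfl
      exact ⟨hpd, fun S hS => hle S hS⟩
  refine ⟨σ, hσ, huniq, hset, ?_, ⟨⟨_, hpd, rfl⟩, ?_⟩, fun hα2 => ?_, fun hα2 => ?_⟩
  · ext k l
    rw [ScatterDepth.scatterMedianMatrix, hset, Set.image_singleton,
      ScatterDepth.uniformBarycenter_singleton]
    rfl
  · rintro _ ⟨S, hS, rfl⟩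
    exact hle S hS
  · have := (key (Or.inl ⟨hα2, rfl⟩)).1
    exact ⟨this, by linarith⟩
  · have := (key (Or.inr ⟨hα2, rfl⟩)).1
    exact ⟨this, by linarith⟩
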